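/- Let $d\ge 2$, let $m_1,\dots,m_p$ be positive integers with $\sum_{j=1}^p m_j=d-1$, and let $\Pi$ be the set of monic centered polynomials $f(z)=z^d+a_1z^{d-2}+\dots+a_{d-1}$ over $\mathbb C$ that have $p$ distinct critical points $c_1,\dots,c_p$ of multiplicities $m_1,\dots,m_p$ (as roots of $f'$). Such an ordered tuple $(c_1,\dots,c_p)$ is called a marking of $f$; write $\bar f=(a_1,\dots,a_{d-1})\in\mathbb C^{d-1}$. Let $H\subset\mathbb C^{p+1}$ be the $p$-dimensional linear subspace of vectors $\bar c=(b,c_1,\dots,c_p)$ with $\sum_j m_jc_j=0$. For $\bar c\in H$ put $f_{\bar c}(z)=b+d\int_0^z\prod_{j}(w-c_j)^{m_j}\,dw$ and $\pi(\bar c)=(f_{\bar c}(c_1),\dots,f_{\bar c}(c_p))\in\mathbb C^p$. (If $f\in\Pi$ is marked by $(c_1,\dots,c_p)$, then $\bar c=(f(0),c_1,\dots,c_p)$ lies in $H$ and $f_{\bar c}=f$.) Fix $f_0\in\Pi$ with a marking $(c_1^0,\dots,c_p^0)$, and let $\bar c_0=(f_0(0),c^0_1,\dots,c^0_p)$ and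 $\bar v_0=(f_0(c_1^0),\dots,f_0(c_p^0))$. 1. The map $\pi$ is a biholomorphic homeomorphism of an open neighborhood of $\bar c_0$ in $H$ onto an open neighborhood of $\bar v_0$ in $\mathbb C^p$. 2. Near $f_0$ the vector $\bar f$ is a holomorphic function of the critical values: there is a map $F:\mathbb C^p\to\mathbb C^{d-1}$, holomorphic in a neighborhood of $\bar v_0$, such that for every $r>0$ with $|c_i^0-c_j^0|\ge 2r$ for all $i\ne j$ the following holds. (a) Every $f\in\Pi$ with $\bar f$ close enough to $\bar f_0$ has exactly one marking $(c_1,\dots,c_p)$ with $|c_j-c_j^0|<r$ for all $j$, and for this marking $\bar f=F(f(c_1),\dots,f(c_p))$. (b) Every $v\in\mathbb C^p$ close enough to $\bar v_0$ equals $(f(c_1),\dots,f(c_p))$ for some $f\in\Pi$ with $\bar f=F(v)$ and some marking $(c_1,\dots,c_p)$ of $f$ with $|c_j-c_j^0|<r$ for all $j$. If moreover all critical points of $f_0$ are simple (all $m_j=1$, so $p=d-1$), then $F$ restricts to a biholomorphic homeomorphism of an open neighborhood of $\bar v_0$ onto an open neighborhood of $\bar f_0$ in $\mathbb C^{d-1}$.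 -/

import Mathlib

open Polynomial Topology Filter

noncomputable section

namespace CritCoord

/-- `c` lists, in a fixed order and without repetition, critical points of `f`, the point `c j`
being a root of `f'` of multiplicity exactly `m j`. -/
def IsMarking {p : ℕ} (m : Fin p → ℕ) (f : ℂ[X]) (c : Fin p → ℂ) : Prop :=
  Function.Injective c ∧ ∀ j, (derivative f).rootMultiplicity (c j) = m j

/-- The monic centered polynomials of degree `d` which have `p` distinct critical points, of
multiplicities `m 0, …, m (p - 1)`. (It is used with `∑ j, m j = d - 1`, so these are all the
critical points.) -/
def PolySpace {p : ℕ} (d : ℕ) (m : Fin p → ℕ) : Set ℂ[X] :=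
  {f | f.Monic ∧ f.natDegree = d ∧ f.coeff (d - 1) = 0 ∧ ∃ c, IsMarking m f c}

/-- The coefficients `(a₁, …, a_{d-1})` of `f = z ^ d + a₁ z ^ (d - 2) + ⋯ + a_{d-1}`; the entry
with index `i : Fin (d - 1)` is `a_{i+1}`. -/
def coeffVec (d : ℕ) (f : ℂ[X]) : Fin (d - 1) → ℂ := fun i => f.coeff (d - 2 - (i : ℕ))

/-- The critical values `v_j = f (c_j)`. -/
def critValues {p : ℕ} (f : ℂ[X]) (c : Fin p → ℂ) : Fin p → ℂ := fun j => f.eval (c j)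

/-- The `p`-dimensional space of the vectors `(b, c₁, …, c_p)` with `∑ m_j c_j = 0`. -/
def critSpace {p : ℕ} (m : Fin p → ℕ) : Submodule ℂ (ℂ × (Fin p → ℂ)) where
  carrier := {x | ∑ j, (m j : ℂ) * x.2 j = 0}
  zero_mem' := by simp
  add_mem' := by
    intro x y hx hy
    simp only [Set.mem_ofPred_eq, Prod.snd_add, Pi.add_apply, mul_add,
      Finset.sum_add_distrib] at *
    rw [hx, hy, add_zero]
  smul_mem' := by
    intro a x hx
    simp only [Set.mem_ofPred_eq, Prod.smul_snd, Pi.smul_apply, smul_eq_mul] at *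
    rw [← mul_zero a, ← hx, Finset.mul_sum]
    exact Finset.sum_congr rfl fun j _ => by ring

/-- The primitive of a polynomial that vanishes at `0`. -/
def primitive (g : ℂ[X]) : ℂ[X] := g.sum fun k a => monomial (k + 1) (a / (k + 1))

/-- The polynomial `d * ∏ (z - c_j) ^ m_j`. -/
def critDeriv {p : ℕ} (d : ℕ) (m : Fin p → ℕ) (c : Fin p → ℂ) : ℂ[X] :=
  C (d : ℂ) * ∏ j, (X - C (c j)) ^ m j

/-- The polynomial `b + d ∫_0^z ∏ (w - c_j) ^ m_j dw` encoded by `(b, c₁, …, c_p)`. -/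
def critPoly {p : ℕ} (d : ℕ) (m : Fin p → ℕ) (x : ℂ × (Fin p → ℂ)) : ℂ[X] :=
  C x.1 + primitive (critDeriv d m x.2)

/-- The map `π : (b, c₁, …, c_p) ↦ (v₁, …, v_p)`, where `v_j = f (c_j)` for the polynomial `f`
encoded by `(b, c₁, …, c_p)`. -/
def critValueMap {p : ℕ} (d : ℕ) (m : Fin p → ℕ) (x : critSpace m) : Fin p → ℂ :=
  critValues (critPoly d m x) (x : ℂ × (Fin p → ℂ)).2

/-- `F` restricts to a biholomorphic homeomorphism of an open neighbourhood of `x` onto an open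
neighbourhood of `F x`; holomorphic means complex analytic. -/
def IsLocalBiholomorphicAt {E G : Type*} [NormedAddCommGroup E] [NormedSpace ℂ E]
    [NormedAddCommGroup G] [NormedSpace ℂ G] (F : E → G) (x : E) : Prop :=
  ∃ e : OpenPartialHomeomorph E G, x ∈ e.source ∧ Set.EqOn e F e.source ∧
    AnalyticOnNhd ℂ e e.source ∧ AnalyticOnNhd ℂ e.symm e.target

theorem derivative_primitive (g : ℂ[X]) : derivative (primitive g) = g := by
  conv_rhs => rw [g.as_sum_support]
  unfold primitive Polynomial.sum
  rw [derivative_sum]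
  refine Finset.sum_congr rfl fun k _ => ?_
  rw [derivative_monomial]
  have : ((k : ℂ) + 1) ≠ 0 := by exact_mod_cast k.succ_ne_zero
  simp [this]

theorem eval_zero_primitive (g : ℂ[X]) : (primitive g).eval 0 = 0 := by
  unfold primitive Polynomial.sum
  simp [eval_finsetSum]

theorem derivative_critPoly {p : ℕ} (d : ℕ) (m : Fin p → ℕ) (x : ℂ × (Fin p → ℂ)) :
    derivative (critPoly d m x) = critDeriv d m x.2 := by
  simp [critPoly, derivative_primitive]

theorem eval_zero_critPoly {p : ℕ} (d : ℕ) (m : Fin p → ℕ) (x : ℂ × (Fin p → ℂ)) :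
    (critPoly d m x).eval 0 = x.1 := by
  simp [critPoly, eval_zero_primitive]

theorem monic_prod {p : ℕ} (m : Fin p → ℕ) (c : Fin p → ℂ) :
    (∏ j, (X - C (c j)) ^ m j).Monic :=
  monic_prod_of_monic _ _ fun j _ => (monic_X_sub_C (c j)).pow (m j)

theorem natDegree_prod {p : ℕ} (m : Fin p → ℕ) (c : Fin p → ℂ) :
    (∏ j, (X - C (c j)) ^ m j).natDegree = ∑ j, m j := by
  rw [natDegree_prod_of_monic _ _ fun j _ => (monic_X_sub_C (c j)).pow (m j)]
  simp

theorem nextCoeff_prod {p : ℕ} (m : Fin p → ℕ) (c : Fin p → ℂ) :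
    (∏ j, (X - C (c j)) ^ m j).nextCoeff = -∑ j, (m j : ℂ) * c j := by
  rw [Monic.nextCoeff_prod _ _ fun j _ => (monic_X_sub_C (c j)).pow (m j)]
  simp [(monic_X_sub_C _).nextCoeff_pow]

/-- `f' = d * ∏ (z - c_j) ^ m_j` for `f` in the space, marked by `c`. -/
theorem derivative_eq_critDeriv {d p : ℕ} {m : Fin p → ℕ} (hd : 2 ≤ d)
    (hsum : ∑ j, m j = d - 1) {f : ℂ[X]} (hf : f ∈ PolySpace d m) {c : Fin p → ℂ}
    (hc : IsMarking m f c) : derivative f = critDeriv d m c := by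
  obtain ⟨hmon, hdeg, -, -⟩ := hf
  have hdvd : (∏ j, (X - C (c j)) ^ m j) ∣ derivative f := by
    refine Finset.prod_dvd_of_coprime (fun i _ j _ hij => ?_) fun j _ => ?_
    · exact (isCoprime_X_sub_C_of_isUnit_sub
        (sub_ne_zero.2 (hc.1.ne hij)).isUnit).pow
    · rw [← hc.2 j]; exact pow_rootMultiplicity_dvd _ _
  have hdeg' : (derivative f).natDegree = d - 1 := by rw [natDegree_derivative, hdeg]
  have hlead : (derivative f).leadingCoeff = d := by
    rw [leadingCoeff, hdeg', coeff_derivative]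
    have : d - 1 + 1 = d := by omega
    rw [this, ← hdeg, hmon.coeff_natDegree, hdeg]
    have : (((d - 1 : ℕ) : ℂ) + 1) = d := by
      rw [← Nat.cast_add_one, this]
    rw [this, one_mul]
  have h := eq_leadingCoeff_mul_of_monic_of_dvd_of_natDegree_le (monic_prod m c) hdvd
    (by rw [hdeg', natDegree_prod, hsum])
  rw [h, hlead, critDeriv]

/-- The vector `(f (0), c₁, …, c_p)` satisfies `∑ m_j c_j = 0`. -/
theorem critCoord_mem {d p : ℕ} {m : Fin p → ℕ} (hd : 2 ≤ d)
    (hsum : ∑ j, m j = d - 1) {f : ℂ[X]} (hf : f ∈ PolySpace d m) {c : Fin p → ℂ}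
    (hc : IsMarking m f c) : (f.eval 0, c) ∈ critSpace m := by
  have h := derivative_eq_critDeriv hd hsum hf hc
  have h1 : (derivative f).coeff (d - 2) = 0 := by
    rw [coeff_derivative, show d - 2 + 1 = d - 1 by omega, hf.2.2.1, zero_mul]
  have h2 := nextCoeff_prod m c
  rw [nextCoeff_of_natDegree_pos (by rw [natDegree_prod]; omega), natDegree_prod, hsum,
    show d - 1 - 1 = d - 2 by omega] at h2
  rw [h, critDeriv, coeff_C_mul, h2] at h1
  have hd0 : (d : ℂ) ≠ 0 := by exact_mod_cast (by omega : d ≠ 0)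
  have h3 := (mul_eq_zero.1 h1).resolve_left hd0
  exact neg_eq_zero.1 h3

/-- The coordinates `(f (0), c₁, …, c_p)` of a marked polynomial. -/
def critCoord {d p : ℕ} {m : Fin p → ℕ} (hd : 2 ≤ d)
    (hsum : ∑ j, m j = d - 1) {f : ℂ[X]} (hf : f ∈ PolySpace d m) {c : Fin p → ℂ}
    (hc : IsMarking m f c) : critSpace m :=
  ⟨(f.eval 0, c), critCoord_mem hd hsum hf hc⟩

/-- A marked polynomial is the one encoded by its coordinates. -/
theorem critPoly_critCoord {d p : ℕ} {m : Fin p → ℕ} (hd : 2 ≤ d)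
    (hsum : ∑ j, m j = d - 1) {f : ℂ[X]} (hf : f ∈ PolySpace d m) {c : Fin p → ℂ}
    (hc : IsMarking m f c) : critPoly d m (critCoord hd hsum hf hc) = f := by
  have h : derivative (critPoly d m (critCoord hd hsum hf hc) - f) = 0 := by
    rw [derivative_sub, derivative_critPoly, derivative_eq_critDeriv hd hsum hf hc, critCoord,
      sub_self]
  have h0 : (critPoly d m (critCoord hd hsum hf hc) - f).eval 0 = 0 := by
    rw [eval_sub, eval_zero_critPoly, critCoord, sub_self]
  rw [eq_C_of_derivative_eq_zero h, eval_C] at h0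
  rw [← sub_eq_zero, eq_C_of_derivative_eq_zero h, h0, C_0]

/-- Each vector of the space with distinct `c_j` encodes a polynomial of the space marked by
`c`, with value `b` at `0`. -/
theorem critPoly_mem {d p : ℕ} {m : Fin p → ℕ} (hd : 2 ≤ d)
    (hsum : ∑ j, m j = d - 1) (x : critSpace m)
    (hx : Function.Injective (x : ℂ × (Fin p → ℂ)).2) :
    critPoly d m x ∈ PolySpace d m ∧
      IsMarking m (critPoly d m x) (x : ℂ × (Fin p → ℂ)).2 := by
  obtain ⟨⟨b, c⟩, hbc⟩ := x
  have hd0 : (d : ℂ) ≠ 0 := by exact_mod_cast (by omega : d ≠ 0)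
  have hder := derivative_critPoly d m (b, c)
  simp only at hder hx ⊢
  have hmark : IsMarking m (critPoly d m (b, c)) c := by
    refine ⟨hx, fun j => ?_⟩
    rw [hder, critDeriv, ← count_roots, roots_C_mul _ hd0, roots_prod _ _ (monic_prod m c).ne_zero]
    simp only [roots_pow, roots_X_sub_C, Multiset.count_bind]
    simp only [Multiset.count_nsmul, Multiset.count_singleton, hx.eq_iff]
    change ∑ k, _ = _
    simp
  have hcoeff : ∀ k : ℕ, (critPoly d m (b, c)).coeff (k + 1) * (k + 1) =
      d * (∏ j, (X - C (c j)) ^ m j).coeff k := by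
    intro k
    rw [← coeff_derivative, hder, critDeriv, coeff_C_mul]
  have hdegle : (critPoly d m (b, c)).natDegree ≤ d := by
    rw [natDegree_le_iff_coeff_eq_zero]
    intro N hN
    obtain ⟨k, rfl⟩ : ∃ k, N = k + 1 := ⟨N - 1, by omega⟩
    have := hcoeff k
    rw [coeff_eq_zero_of_natDegree_lt (n := k) (by rw [natDegree_prod]; omega), mul_zero] at this
    exact (mul_eq_zero.1 this).resolve_right (by exact_mod_cast k.succ_ne_zero)
  have htop : (critPoly d m (b, c)).coeff d = 1 := by
    have h := hcoeff (d - 1)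
    have h1 := (monic_prod m c).coeff_natDegree
    rw [natDegree_prod, hsum] at h1
    rw [h1, ← Nat.cast_add_one, show d - 1 + 1 = d by omega, mul_one] at h
    exact mul_right_cancel₀ hd0 (by rw [h, one_mul])
  have hdeg : (critPoly d m (b, c)).natDegree = d :=
    natDegree_eq_of_le_of_coeff_ne_zero hdegle (by rw [htop]; exact one_ne_zero)
  refine ⟨⟨?_, hdeg, ?_, c, hmark⟩, hmark⟩
  · rw [Monic, leadingCoeff, hdeg, htop]
  · have h := hcoeff (d - 2)
    have h2 := nextCoeff_prod m c
    rw [nextCoeff_of_natDegree_pos (by rw [natDegree_prod]; omega), natDegree_prod, hsum,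
      show d - 1 - 1 = d - 2 by omega] at h2
    have h3 : ∑ j, (m j : ℂ) * c j = 0 := hbc
    rw [h2, h3, neg_zero, mul_zero, show d - 2 + 1 = d - 1 by omega] at h
    exact (mul_eq_zero.1 h).resolve_right (by exact_mod_cast (d - 2).succ_ne_zero)

end CritCoord

end

/-! Both maps on $H$, the critical value map $\pi$ and the coefficient map $\Phi$ (`critCoeffMap`),
are polynomial, so the inverse function theorem reduces local biholomorphy to injectivity of the
derivative and a dimension count.

Move $\bar c$ in a direction $h=(\beta,\gamma)\in H$ and let $q$ be the derivative of $f_{\bar c}$.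
Since $f_{\bar c}$ stays monic and centered, $\deg q<d-1$. As $f'(c_j)=0$, the derivative of the
$j$-th critical value is $q(c_j)$. If these all vanish, then, because $q'$ is divisible by
$(z-c_j)^{m_j-1}$, $q$ is divisible by $\prod(z-c_j)^{m_j}$, of degree $d-1$, so $q=0$. Reading
$q'=0$ at each $c_j$ gives $\gamma=0$, and $q(0)=\beta$ gives $\beta=0$
(`exists_hasCoeffDerivAt_critPoly`). As $\dim H=p$, $\pi$ is locally biholomorphic, and
$F=\Phi\circ\pi^{-1}$.

For (a), coefficients near $\bar f_0$ must force some admissible reordering of the critical points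
to be near $\bar c_0$. This is a compactness argument (`eventually_exists_permCoord_mem`): $\Phi$ is
proper by Cauchy's root bound, and its fibre over $\bar f_0$ consists of reorderings of $\bar c_0$.
If all $m_j=1$, then $\Phi$ is locally biholomorphic too, hence so is $F$. -/

namespace CritCoord

/-! ### Inverse function theorem -/

/-- Inverse function theorem: an analytic map between finite-dimensional spaces of the same
dimension whose derivative is injective at a point is locally biholomorphic there. -/
theorem isLocalBiholomorphicAt_of_fderiv_injective {E G : Type*} [NormedAddCommGroup E]
    [NormedSpace ℂ E] [FiniteDimensional ℂ E] [NormedAddCommGroup G] [NormedSpace ℂ G]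
    [FiniteDimensional ℂ G] (hdim : Module.finrank ℂ E = Module.finrank ℂ G) {f : E → G} {x : E}
    (hf : AnalyticAt ℂ f x) (hinj : ∀ h, fderiv ℂ f x h = 0 → h = 0) :
    IsLocalBiholomorphicAt f x := by
  have : CompleteSpace E := FiniteDimensional.complete ℂ E
  have : CompleteSpace G := FiniteDimensional.complete ℂ G
  let f' : E ≃L[ℂ] G := (LinearEquiv.ofInjectiveOfFinrankEq (fderiv ℂ f x : E →ₗ[ℂ] G)
    ((injective_iff_map_eq_zero _).2 hinj) hdim).toContinuousLinearEquiv
  have hf' : (f' : E →L[ℂ] G) = fderiv ℂ f x := by ext h; rfl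
  have hs : HasStrictFDerivAt f (f' : E →L[ℂ] G) x := by rw [hf']; exact hf.hasStrictFDerivAt
  let e₀ := hs.toOpenPartialHomeomorph f
  have he₀ : (e₀ : E → G) = f := hs.toOpenPartialHomeomorph_coe
  have hx₀ : x ∈ e₀.source := hs.mem_toOpenPartialHomeomorph_source
  have hsymm : AnalyticAt ℂ e₀.symm (f x) := by
    have h := e₀.analyticAt_symm' (i := f') hx₀ (by rw [he₀]; exact hf)
      (by rw [he₀]; exact hf'.symm)
    rwa [he₀] at h
  -- Analyticity is required on the whole source and the whole target, so the source is cut down to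
  -- the points where `f` is analytic, then the target to those where the inverse is.
  let e₁ := e₀.restrOpen {y | AnalyticAt ℂ f y} (isOpen_analyticAt ℂ f)
  have he₁ : (e₁ : E → G) = f := he₀
  have hx₁ : x ∈ e₁.source := ⟨hx₀, hf⟩
  let e₂ := (e₁.symm.restrOpen {y | AnalyticAt ℂ e₀.symm y} (isOpen_analyticAt ℂ _)).symm
  have he₂ : (e₂ : E → G) = f := he₀
  have hsub : e₂.source ⊆ e₁.source := fun y hy => hy.1
  have htgt : e₂.target = e₁.target ∩ {y | AnalyticAt ℂ e₀.symm y} := rfl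
  refine ⟨e₂, ?_, fun y _ => by rw [he₂], fun y hy => ?_, fun y hy => ?_⟩
  · have h1 : f x ∈ e₂.target := by
      rw [htgt]
      refine ⟨?_, hsymm⟩
      rw [← he₁]
      exact e₁.map_source hx₁
    have h2 := e₂.map_target h1
    have h3 : e₂.symm (f x) = x := by
      change e₁.symm (f x) = x
      rw [← he₁]
      exact e₁.left_inv hx₁
    rwa [h3] at h2
  · rw [he₂]; exact (hsub hy).2
  · exact hy.2

/-! ### Coefficientwise differentiation of polynomials -/

/-- The coefficients of `P t` have at `t` the derivatives given by the coefficients of `Q`. -/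
def HasCoeffDerivAt (P : ℂ → ℂ[X]) (Q : ℂ[X]) (t : ℂ) : Prop :=
  ∀ k, HasDerivAt (fun s => (P s).coeff k) (Q.coeff k) t

theorem HasCoeffDerivAt.unique {P : ℂ → ℂ[X]} {Q R : ℂ[X]} {t : ℂ} (hQ : HasCoeffDerivAt P Q t)
    (hR : HasCoeffDerivAt P R t) : Q = R := by
  ext k; exact (hQ k).unique (hR k)

theorem HasCoeffDerivAt.mul {P₁ P₂ : ℂ → ℂ[X]} {Q₁ Q₂ : ℂ[X]} {t : ℂ}
    (h₁ : HasCoeffDerivAt P₁ Q₁ t) (h₂ : HasCoeffDerivAt P₂ Q₂ t) :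
    HasCoeffDerivAt (fun s => P₁ s * P₂ s) (Q₁ * P₂ t + P₁ t * Q₂) t := by
  intro k
  simp only [coeff_mul, coeff_add, ← Finset.sum_add_distrib]
  exact HasDerivAt.fun_sum fun i _ => (h₁ i.1).mul (h₂ i.2)

theorem hasCoeffDerivAt_const (P : ℂ[X]) (t : ℂ) : HasCoeffDerivAt (fun _ => P) 0 t := by
  intro k; simpa using hasDerivAt_const t (P.coeff k)

theorem hasCoeffDerivAt_C {a : ℂ → ℂ} {a' t : ℂ} (h : HasDerivAt a a' t) :
    HasCoeffDerivAt (fun s => C (a s)) (C a') t := by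
  intro k
  simp only [coeff_C]
  split_ifs
  · exact h
  · exact hasDerivAt_const _ _

theorem HasCoeffDerivAt.add {P₁ P₂ : ℂ → ℂ[X]} {Q₁ Q₂ : ℂ[X]} {t : ℂ}
    (h₁ : HasCoeffDerivAt P₁ Q₁ t) (h₂ : HasCoeffDerivAt P₂ Q₂ t) :
    HasCoeffDerivAt (fun s => P₁ s + P₂ s) (Q₁ + Q₂) t := by
  intro k
  simp only [coeff_add]
  exact (h₁ k).add (h₂ k)

theorem HasCoeffDerivAt.pow {P : ℂ → ℂ[X]} {Q : ℂ[X]} {t : ℂ} (h : HasCoeffDerivAt P Q t)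
    (n : ℕ) : HasCoeffDerivAt (fun s => P s ^ n) (n * P t ^ (n - 1) * Q) t := by
  induction n with
  | zero => simpa using hasCoeffDerivAt_const 1 t
  | succ n ih =>
    have h' := ih.mul h
    simp only [← pow_succ] at h'
    convert h' using 1
    -- For `n = 0` the exponent `n - 1` truncates, but its term carries the factor `n = 0`.
    rcases n with _ | n
    · simp
    · simp only [Nat.add_sub_cancel]; push_cast; ring

/-- Existence suffices: by uniqueness of the derivative, its shape can be read off after splitting
off any one factor. -/
theorem exists_hasCoeffDerivAt_prod {ι : Type*} (s : Finset ι) {P : ι → ℂ → ℂ[X]} {t : ℂ}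
    (h : ∀ i ∈ s, ∃ Q, HasCoeffDerivAt (P i) Q t) :
    ∃ Q, HasCoeffDerivAt (fun t => ∏ i ∈ s, P i t) Q t := by
  classical
  induction s using Finset.induction_on with
  | empty => exact ⟨0, by simpa using hasCoeffDerivAt_const 1 t⟩
  | insert a s ha ih =>
    obtain ⟨Q₁, h₁⟩ := h a (Finset.mem_insert_self _ _)
    obtain ⟨Q₂, h₂⟩ := ih fun i hi => h i (Finset.mem_insert_of_mem hi)
    exact ⟨_, by simpa only [Finset.prod_insert ha] using h₁.mul h₂⟩

theorem coeff_primitive_zero (g : ℂ[X]) : (primitive g).coeff 0 = 0 := by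
  rw [coeff_zero_eq_eval_zero, eval_zero_primitive]

theorem coeff_primitive_succ (g : ℂ[X]) (k : ℕ) :
    (primitive g).coeff (k + 1) = g.coeff k / (k + 1) := by
  have h := congrArg (fun q => coeff q k) (derivative_primitive g)
  simp only [coeff_derivative] at h
  rw [← h, mul_div_cancel_right₀]
  exact_mod_cast k.succ_ne_zero

theorem HasCoeffDerivAt.primitive {P : ℂ → ℂ[X]} {Q : ℂ[X]} {t : ℂ} (h : HasCoeffDerivAt P Q t) :
    HasCoeffDerivAt (fun s => primitive (P s)) (primitive Q) t := by
  intro k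
  rcases k with _ | k
  · simpa only [coeff_primitive_zero] using hasDerivAt_const t (0 : ℂ)
  · simpa only [coeff_primitive_succ] using (h k).div_const _

theorem HasCoeffDerivAt.natDegree_le {P : ℂ → ℂ[X]} {Q : ℂ[X]} {t : ℂ} {n : ℕ}
    (h : HasCoeffDerivAt P Q t) (hn : ∀ s, (P s).natDegree ≤ n) : Q.natDegree ≤ n := by
  rw [natDegree_le_iff_coeff_eq_zero]
  intro k hk
  have h0 : (fun s => (P s).coeff k) = fun _ => 0 :=
    funext fun s => coeff_eq_zero_of_natDegree_lt ((hn s).trans_lt hk)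
  have := h k
  rw [h0] at this
  exact this.unique (hasDerivAt_const _ _)

/-- The uniform degree bound turns evaluation into a sum of fixed length. -/
theorem HasCoeffDerivAt.eval {P : ℂ → ℂ[X]} {Q : ℂ[X]} {t : ℂ} {n : ℕ}
    (h : HasCoeffDerivAt P Q t) (hn : ∀ s, (P s).natDegree ≤ n) {z : ℂ → ℂ} {z' : ℂ}
    (hz : HasDerivAt z z' t) :
    HasDerivAt (fun s => (P s).eval (z s)) (Q.eval (z t) + (derivative (P t)).eval (z t) * z') t := by
  have e1 : (fun s => (P s).eval (z s)) =
      fun s => ∑ k ∈ Finset.range (n + 1), (P s).coeff k * z s ^ k :=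
    funext fun s => eval_eq_sum_range' (Nat.lt_succ_of_le (hn s)) _
  rw [e1]
  have h1 := HasDerivAt.fun_sum (u := Finset.range (n + 1)) fun k _ => (h k).mul (hz.pow k)
  convert! h1 using 1
  rw [Finset.sum_add_distrib,
    eval_eq_sum_range' (Nat.lt_succ_of_le (h.natDegree_le hn)), derivative_eval,
    (P t).sum_over_range' (by simp) _ (Nat.lt_succ_of_le (hn t)), Finset.sum_mul]
  congr 1
  exact Finset.sum_congr rfl fun k _ => by ring

/-! ### Analytic dependence of polynomials on parameters -/

/-- All coefficients of a polynomial depending on a parameter are analytic functions of it. -/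
def CoeffAnalytic {E : Type*} [NormedAddCommGroup E] [NormedSpace ℂ E] (P : E → ℂ[X]) : Prop :=
  ∀ k x, AnalyticAt ℂ (fun y => (P y).coeff k) x

section CoeffAnalytic

variable {E : Type*} [NormedAddCommGroup E] [NormedSpace ℂ E]

theorem coeffAnalytic_const (P : ℂ[X]) : CoeffAnalytic fun _ : E => P :=
  fun _ _ => analyticAt_const

theorem coeffAnalytic_C {a : E → ℂ} (h : ∀ x, AnalyticAt ℂ a x) :
    CoeffAnalytic fun x => C (a x) := by
  intro k x
  simp only [coeff_C]
  split_ifs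
  · exact h x
  · exact analyticAt_const

theorem CoeffAnalytic.add {P Q : E → ℂ[X]} (hP : CoeffAnalytic P) (hQ : CoeffAnalytic Q) :
    CoeffAnalytic fun x => P x + Q x := by
  intro k x
  simp only [coeff_add]
  exact (hP k x).add (hQ k x)

theorem CoeffAnalytic.sub {P Q : E → ℂ[X]} (hP : CoeffAnalytic P) (hQ : CoeffAnalytic Q) :
    CoeffAnalytic fun x => P x - Q x := by
  intro k x
  simp only [coeff_sub]
  exact (hP k x).sub (hQ k x)

theorem CoeffAnalytic.mul {P Q : E → ℂ[X]} (hP : CoeffAnalytic P) (hQ : CoeffAnalytic Q) :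
    CoeffAnalytic fun x => P x * Q x := by
  intro k x
  simp only [coeff_mul]
  exact Finset.analyticAt_fun_sum _ fun i _ => (hP i.1 x).mul (hQ i.2 x)

theorem CoeffAnalytic.pow {P : E → ℂ[X]} (hP : CoeffAnalytic P) (n : ℕ) :
    CoeffAnalytic fun x => P x ^ n := by
  induction n with
  | zero => simpa using coeffAnalytic_const 1
  | succ n ih => simpa only [pow_succ] using ih.mul hP

theorem coeffAnalytic_prod {ι : Type*} (s : Finset ι) {P : ι → E → ℂ[X]}
    (h : ∀ i ∈ s, CoeffAnalytic (P i)) : CoeffAnalytic fun x => ∏ i ∈ s, P i x := by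
  classical
  induction s using Finset.induction_on with
  | empty => simpa using coeffAnalytic_const 1
  | insert a s ha ih =>
    simpa only [Finset.prod_insert ha] using (h a (Finset.mem_insert_self _ _)).mul
      (ih fun i hi => h i (Finset.mem_insert_of_mem hi))

theorem CoeffAnalytic.primitive {P : E → ℂ[X]} (hP : CoeffAnalytic P) :
    CoeffAnalytic fun x => primitive (P x) := by
  intro k x
  rcases k with _ | k
  · simpa only [coeff_primitive_zero] using analyticAt_const
  · simp only [coeff_primitive_succ]
    exact (hP k x).div_const

theorem CoeffAnalytic.eval {P : E → ℂ[X]} (hP : CoeffAnalytic P) {n : ℕ}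
    (hn : ∀ x, (P x).natDegree ≤ n) {z : E → ℂ} {x : E} (hz : AnalyticAt ℂ z x) :
    AnalyticAt ℂ (fun y => (P y).eval (z y)) x := by
  have e1 : (fun y => (P y).eval (z y)) =
      fun y => ∑ k ∈ Finset.range (n + 1), (P y).coeff k * z y ^ k :=
    funext fun y => eval_eq_sum_range' (Nat.lt_succ_of_le (hn y)) _
  rw [e1]
  exact Finset.analyticAt_fun_sum _ fun k _ => (hP k x).mul (hz.pow k)

end CoeffAnalytic

/-! ### Coefficients of the encoded polynomial -/

variable {d p : ℕ} {m : Fin p → ℕ}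

theorem coeff_critPoly_zero (x : ℂ × (Fin p → ℂ)) : (critPoly d m x).coeff 0 = x.1 := by
  rw [coeff_zero_eq_eval_zero, eval_zero_critPoly]

theorem coeff_critPoly_succ (x : ℂ × (Fin p → ℂ)) (k : ℕ) :
    (critPoly d m x).coeff (k + 1) = d * (∏ j, (X - C (x.2 j)) ^ m j).coeff k / (k + 1) := by
  rw [critPoly, coeff_add, coeff_primitive_succ, critDeriv, coeff_C_mul, coeff_C_succ, zero_add]

theorem natDegree_critPoly_le (hd : 2 ≤ d) (hsum : ∑ j, m j = d - 1) (x : ℂ × (Fin p → ℂ)) :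
    (critPoly d m x).natDegree ≤ d := by
  rw [natDegree_le_iff_coeff_eq_zero]
  intro N hN
  obtain ⟨k, rfl⟩ : ∃ k, N = k + 1 := ⟨N - 1, by omega⟩
  rw [coeff_critPoly_succ,
    coeff_eq_zero_of_natDegree_lt (n := k) (by rw [natDegree_prod]; omega), mul_zero, zero_div]

theorem coeff_critPoly_top (hd : 2 ≤ d) (hsum : ∑ j, m j = d - 1) (x : ℂ × (Fin p → ℂ)) :
    (critPoly d m x).coeff d = 1 := by
  have h1 := (monic_prod m x.2).coeff_natDegree
  rw [natDegree_prod, hsum] at h1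
  have h := coeff_critPoly_succ (d := d) (m := m) x (d - 1)
  rw [h1, ← Nat.cast_add_one, show d - 1 + 1 = d by omega, mul_one, div_self] at h
  · exact h
  · exact_mod_cast (by omega : d ≠ 0)

theorem coeff_critPoly_sub_one (hd : 2 ≤ d) (hsum : ∑ j, m j = d - 1) {x : ℂ × (Fin p → ℂ)}
    (hx : x ∈ critSpace m) : (critPoly d m x).coeff (d - 1) = 0 := by
  have h := coeff_critPoly_succ (d := d) (m := m) x (d - 2)
  have h2 := nextCoeff_prod m x.2
  rw [nextCoeff_of_natDegree_pos (by rw [natDegree_prod]; omega), natDegree_prod, hsum,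
    show d - 1 - 1 = d - 2 by omega] at h2
  have h3 : ∑ j, (m j : ℂ) * x.2 j = 0 := hx
  rwa [h2, h3, neg_zero, mul_zero, zero_div, show d - 2 + 1 = d - 1 by omega] at h

/-- The coefficients of a polynomial encoded by a vector of the space that are not listed by
`coeffVec` do not depend on the vector. -/
theorem coeff_critPoly_eq_of_le (hd : 2 ≤ d) (hsum : ∑ j, m j = d - 1) {x y : ℂ × (Fin p → ℂ)}
    (hx : x ∈ critSpace m) (hy : y ∈ critSpace m) {k : ℕ} (hk : d - 1 ≤ k) :
    (critPoly d m x).coeff k = (critPoly d m y).coeff k := by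
  rcases Nat.lt_or_ge d k with h | h
  · rw [coeff_eq_zero_of_natDegree_lt ((natDegree_critPoly_le hd hsum x).trans_lt h),
      coeff_eq_zero_of_natDegree_lt ((natDegree_critPoly_le hd hsum y).trans_lt h)]
  · obtain rfl | rfl : k = d ∨ k = d - 1 := by omega
    · rw [coeff_critPoly_top hd hsum, coeff_critPoly_top hd hsum]
    · rw [coeff_critPoly_sub_one hd hsum hx, coeff_critPoly_sub_one hd hsum hy]

theorem coeff_eq_coeffVec (f : ℂ[X]) {k : ℕ} (hk : k < d - 1) :
    f.coeff k = coeffVec d f ⟨d - 2 - k, by omega⟩ := by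
  simp only [coeffVec]
  congr 1
  omega

theorem critPoly_eq_of_coeffVec_eq (hd : 2 ≤ d) (hsum : ∑ j, m j = d - 1)
    {x y : ℂ × (Fin p → ℂ)} (hx : x ∈ critSpace m) (hy : y ∈ critSpace m)
    (h : coeffVec d (critPoly d m x) = coeffVec d (critPoly d m y)) :
    critPoly d m x = critPoly d m y := by
  ext k
  rcases Nat.lt_or_ge k (d - 1) with hk | hk
  · rw [coeff_eq_coeffVec _ hk, coeff_eq_coeffVec _ hk, h]
  · exact coeff_critPoly_eq_of_le hd hsum hx hy hk

theorem coeffAnalytic_critPoly :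
    CoeffAnalytic fun x : critSpace m => critPoly d m (x : ℂ × (Fin p → ℂ)) := by
  have h1 : ∀ x : critSpace m, AnalyticAt ℂ (fun y : critSpace m => (y : ℂ × (Fin p → ℂ)).1) x :=
    fun x => ((ContinuousLinearMap.fst ℂ ℂ (Fin p → ℂ)).comp (critSpace m).subtypeL).analyticAt x
  have h2 : ∀ (j : Fin p) (x : critSpace m),
      AnalyticAt ℂ (fun y : critSpace m => (y : ℂ × (Fin p → ℂ)).2 j) x :=
    fun j x => ((ContinuousLinearMap.proj j).comp
      ((ContinuousLinearMap.snd ℂ ℂ (Fin p → ℂ)).comp (critSpace m).subtypeL)).analyticAt x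
  exact (coeffAnalytic_C h1).add (CoeffAnalytic.primitive ((coeffAnalytic_const _).mul
    (coeffAnalytic_prod _ fun j _ =>
      ((coeffAnalytic_const X).sub (coeffAnalytic_C (h2 j))).pow (m j))))

theorem analyticAt_critValueMap (hd : 2 ≤ d) (hsum : ∑ j, m j = d - 1) (x : critSpace m) :
    AnalyticAt ℂ (critValueMap d m) x := by
  rw [analyticAt_pi_iff]
  intro j
  have hz : AnalyticAt ℂ (fun y : critSpace m => (y : ℂ × (Fin p → ℂ)).2 j) x :=
    ((ContinuousLinearMap.proj j).comp
      ((ContinuousLinearMap.snd ℂ ℂ (Fin p → ℂ)).comp (critSpace m).subtypeL)).analyticAt x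
  exact CoeffAnalytic.eval (P := fun y : critSpace m => critPoly d m (y : ℂ × (Fin p → ℂ)))
    coeffAnalytic_critPoly (fun y => natDegree_critPoly_le hd hsum y) hz

/-- The map `(b, c₁, …, c_p) ↦ (a₁, …, a_{d-1})` to the coefficients of the encoded polynomial. -/
noncomputable def critCoeffMap (d : ℕ) (m : Fin p → ℕ) (x : critSpace m) : Fin (d - 1) → ℂ :=
  coeffVec d (critPoly d m x)

theorem analyticAt_critCoeffMap (x : critSpace m) : AnalyticAt ℂ (critCoeffMap d m) x := by
  rw [analyticAt_pi_iff]
  intro j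
  exact coeffAnalytic_critPoly _ x

/-! ### Injectivity of the derivatives -/

/-- A polynomial of degree less than `∑ m_j` that vanishes at the distinct points `c_j`, and whose
derivative vanishes there to the order `m_j - 1`, is zero. -/
theorem eq_zero_of_pow_dvd_derivative {q : ℂ[X]} {c : Fin p → ℂ} (hc : Function.Injective c)
    (hdeg : ∀ k, ∑ j, m j ≤ k → q.coeff k = 0) (hq : ∀ j, q.eval (c j) = 0)
    (hdvd : ∀ j, (X - C (c j)) ^ (m j - 1) ∣ derivative q) : q = 0 := by
  by_contra hq0
  have hmul : ∀ j, (X - C (c j)) ^ m j ∣ q := by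
    intro j
    rw [← le_rootMultiplicity_iff hq0]
    have h1 : 0 < q.rootMultiplicity (c j) := (rootMultiplicity_pos hq0).2 (hq j)
    by_cases hder : derivative q = 0
    · have := eq_C_of_derivative_eq_zero hder
      have h0 := hq j
      rw [this, eval_C] at h0
      rw [h0, C_0] at this
      exact absurd this hq0
    · have h2 := (le_rootMultiplicity_iff hder).2 (hdvd j)
      -- Differentiation lowers the multiplicity of a root by exactly one; `h1` makes up for the
      -- truncated subtraction.
      rw [derivative_rootMultiplicity_of_root (hq j)] at h2
      omega
  have hprod : (∏ j, (X - C (c j)) ^ m j) ∣ q :=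
    Finset.prod_dvd_of_coprime (fun i _ j _ hij => (isCoprime_X_sub_C_of_isUnit_sub
      (sub_ne_zero.2 (hc.ne hij)).isUnit).pow) fun j _ => hmul j
  have h := natDegree_le_of_dvd hprod hq0
  rw [natDegree_prod] at h
  exact hq0 (leadingCoeff_eq_zero.1 (hdeg _ h))

/-- The derivative of `∏ (X - c_j) ^ m_j` along a line in the space of the `c`. -/
theorem exists_hasCoeffDerivAt_prod_pow (hm : ∀ j, 0 < m j) {c : Fin p → ℂ}
    (hc : Function.Injective c) (γ : Fin p → ℂ) :
    ∃ Q, HasCoeffDerivAt (fun t => ∏ j, (X - C (c j + t * γ j)) ^ m j) Q 0 ∧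
      (∀ j, (X - C (c j)) ^ (m j - 1) ∣ Q) ∧ (Q = 0 → γ = 0) := by
  classical
  have hlin : ∀ j, HasCoeffDerivAt (fun t => X - C (c j + t * γ j)) (C (-γ j)) 0 := by
    intro j
    have h : HasDerivAt (fun t : ℂ => -(c j + t * γ j)) (-γ j) 0 := by
      have h1 : HasDerivAt (fun t : ℂ => c j + t * γ j) (γ j) 0 := by
        simpa using ((hasDerivAt_id (0 : ℂ)).mul_const (γ j)).const_add (c j)
      exact h1.neg
    simpa [sub_eq_add_neg] using (hasCoeffDerivAt_const X 0).add (hasCoeffDerivAt_C h)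
  have hpow : ∀ j, HasCoeffDerivAt (fun t => (X - C (c j + t * γ j)) ^ m j)
      ((m j : ℂ[X]) * (X - C (c j)) ^ (m j - 1) * C (-γ j)) 0 := by
    intro j
    have h := (hlin j).pow (m j)
    rwa [zero_mul, add_zero] at h
  obtain ⟨Q, hQ⟩ := exists_hasCoeffDerivAt_prod Finset.univ
    (P := fun j t => (X - C (c j + t * γ j)) ^ m j) (t := 0) fun j _ => ⟨_, hpow j⟩
  -- Product rule with the `j`-th factor split off. At `c j` the bracket equals
  -- $-m_j\gamma_j\prod_{i\ne j}(c_j-c_i)^{m_i}$, which vanishes only if $\gamma_j=0$.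
  have hsplit : ∀ j, ∃ S, Q = (X - C (c j)) ^ (m j - 1) *
      (C (-(m j * γ j)) * (∏ i ∈ Finset.univ.erase j, (X - C (c i)) ^ m i) +
        (X - C (c j)) * S) := by
    intro j
    obtain ⟨S, hS⟩ := exists_hasCoeffDerivAt_prod (Finset.univ.erase j)
      (P := fun j t => (X - C (c j + t * γ j)) ^ m j) (t := 0) fun i _ => ⟨_, hpow i⟩
    refine ⟨S, ?_⟩
    have h := (hpow j).mul hS
    have hprod : (fun t => (X - C (c j + t * γ j)) ^ m j *
        ∏ i ∈ Finset.univ.erase j, (X - C (c i + t * γ i)) ^ m i) =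
        fun t => ∏ i, (X - C (c i + t * γ i)) ^ m i :=
      funext fun t => Finset.mul_prod_erase Finset.univ
        (fun i => (X - C (c i + t * γ i)) ^ m i) (Finset.mem_univ j)
    rw [hprod] at h
    rw [hQ.unique h]
    obtain ⟨n, hn⟩ : ∃ n, m j = n + 1 := ⟨m j - 1, by have := hm j; omega⟩
    simp only [zero_mul, add_zero, hn, Nat.add_sub_cancel, pow_succ]
    simp only [map_neg, map_mul, map_natCast]
    ring
  refine ⟨Q, hQ, fun j => ?_, fun h0 => ?_⟩
  · obtain ⟨S, hS⟩ := hsplit j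
    exact hS ▸ dvd_mul_right _ _
  · ext j
    obtain ⟨S, hS⟩ := hsplit j
    rw [h0, eq_comm, mul_eq_zero] at hS
    have h := congrArg (Polynomial.eval (c j))
      (hS.resolve_left (pow_ne_zero _ (X_sub_C_ne_zero _)))
    simp only [eval_add, eval_mul, eval_C, eval_sub, eval_X, sub_self, zero_mul, add_zero,
      eval_zero, eval_prod, eval_pow, mul_eq_zero, neg_eq_zero, Nat.cast_eq_zero,
      (hm j).ne', false_or] at h
    refine h.resolve_right (Finset.prod_ne_zero_iff.2 fun i hi => pow_ne_zero _ ?_)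
    exact sub_ne_zero.2 (hc.ne (Finset.ne_of_mem_erase hi).symm)

/-- The derivative of the encoded polynomial along a line of the space: it vanishes only in the
direction zero, and it is determined by its values at the critical points. -/
theorem exists_hasCoeffDerivAt_critPoly (hd : 2 ≤ d) (hm : ∀ j, 0 < m j)
    (hsum : ∑ j, m j = d - 1) {x : critSpace m}
    (hx : Function.Injective (x : ℂ × (Fin p → ℂ)).2) (h : critSpace m) :
    ∃ q, HasCoeffDerivAt (fun t => critPoly d m (x + t • h : critSpace m)) q 0 ∧
      (∀ k, d - 1 ≤ k → q.coeff k = 0) ∧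
      ((∀ j, q.eval ((x : ℂ × (Fin p → ℂ)).2 j) = 0) → q = 0) ∧ (q = 0 → h = 0) := by
  have hd0 : (d : ℂ) ≠ 0 := by exact_mod_cast (by omega : d ≠ 0)
  obtain ⟨Q, hQ, hdvd, hQ0⟩ := exists_hasCoeffDerivAt_prod_pow hm hx (h : ℂ × (Fin p → ℂ)).2
  have hb : HasDerivAt (fun t : ℂ => (x : ℂ × (Fin p → ℂ)).1 + t * (h : ℂ × (Fin p → ℂ)).1)
      (h : ℂ × (Fin p → ℂ)).1 0 := by
    simpa using ((hasDerivAt_id (0 : ℂ)).mul_const (h : ℂ × (Fin p → ℂ)).1).const_add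
      (x : ℂ × (Fin p → ℂ)).1
  have hq : HasCoeffDerivAt (fun t => critPoly d m (x + t • h : critSpace m))
      (C (h : ℂ × (Fin p → ℂ)).1 + primitive (C (d : ℂ) * Q)) 0 := by
    have h1 := (hasCoeffDerivAt_C hb).add ((hasCoeffDerivAt_const (C (d : ℂ)) 0).mul hQ).primitive
    rw [zero_mul, zero_add] at h1
    exact h1
  have hder : derivative (C (h : ℂ × (Fin p → ℂ)).1 + primitive (C (d : ℂ) * Q)) =
      C (d : ℂ) * Q := by
    simp [derivative_primitive]
  -- The line stays in the space, where the coefficients from index `d - 1` on are constant.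
  have hcoeff : ∀ k, d - 1 ≤ k →
      (C (h : ℂ × (Fin p → ℂ)).1 + primitive (C (d : ℂ) * Q)).coeff k = 0 := by
    intro k hk
    have h1 := hq k
    have h2 : (fun t : ℂ => (critPoly d m (x + t • h : critSpace m)).coeff k) =
        fun _ => (critPoly d m x).coeff k :=
      funext fun t => coeff_critPoly_eq_of_le hd hsum (x + t • h).2 x.2 hk
    rw [h2] at h1
    exact h1.unique (hasDerivAt_const _ _)
  refine ⟨_, hq, hcoeff, fun hv => ?_, fun h0 => ?_⟩
  · refine eq_zero_of_pow_dvd_derivative hx (by rwa [hsum]) hv fun j => ?_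
    rw [hder]
    exact (hdvd j).mul_left _
  · rw [h0, derivative_zero, eq_comm, mul_eq_zero, C_eq_zero] at hder
    have h1 := congrArg (Polynomial.eval 0) h0
    rw [eval_add, eval_zero_primitive, eval_C, add_zero, eval_zero] at h1
    exact Subtype.ext (Prod.ext h1 (hQ0 (hder.resolve_left hd0)))

theorem hasDerivAt_comp_line {E G : Type*} [NormedAddCommGroup E] [NormedSpace ℂ E]
    [NormedAddCommGroup G] [NormedSpace ℂ G] {f : E → G} {x : E} (hf : DifferentiableAt ℂ f x)
    (h : E) : HasDerivAt (fun t : ℂ => f (x + t • h)) (fderiv ℂ f x h) 0 := by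
  have h1 : HasDerivAt (fun t : ℂ => x + t • h) h 0 := by
    simpa using ((hasDerivAt_id (0 : ℂ)).smul_const h).const_add x
  exact hf.hasFDerivAt.comp_hasDerivAt_of_eq 0 h1 (by simp)

/-- The motion of the critical point contributes $f'(c_j)\gamma_j=0$, so only $q(c_j)$ remains. -/
theorem fderiv_critValueMap_injective (hd : 2 ≤ d) (hm : ∀ j, 0 < m j)
    (hsum : ∑ j, m j = d - 1) {x : critSpace m}
    (hx : Function.Injective (x : ℂ × (Fin p → ℂ)).2) (h : critSpace m)
    (h0 : fderiv ℂ (critValueMap d m) x h = 0) : h = 0 := by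
  obtain ⟨q, hq, -, hv, hz⟩ := exists_hasCoeffDerivAt_critPoly hd hm hsum hx h
  refine hz (hv fun j => ?_)
  have h1 := hasDerivAt_comp_line (analyticAt_critValueMap hd hsum x).differentiableAt h
  rw [h0, hasDerivAt_pi] at h1
  have hc : HasDerivAt (fun t : ℂ => ((x + t • h : critSpace m) : ℂ × (Fin p → ℂ)).2 j)
      ((h : ℂ × (Fin p → ℂ)).2 j) 0 := by
    simpa using ((hasDerivAt_id (0 : ℂ)).mul_const ((h : ℂ × (Fin p → ℂ)).2 j)).const_add
      ((x : ℂ × (Fin p → ℂ)).2 j)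
  have h2 := (h1 j).unique (hq.eval (fun t => natDegree_critPoly_le hd hsum _) hc)
  have h3 : (critDeriv d m (x : ℂ × (Fin p → ℂ)).2).eval ((x : ℂ × (Fin p → ℂ)).2 j) = 0 := by
    rw [critDeriv, eval_mul, eval_prod,
      Finset.prod_eq_zero (Finset.mem_univ j) (by simp [(hm j).ne']), mul_zero]
  rw [derivative_critPoly, zero_smul, add_zero, h3, zero_mul, add_zero] at h2
  exact h2.symm

theorem fderiv_critCoeffMap_injective (hd : 2 ≤ d) (hm : ∀ j, 0 < m j)
    (hsum : ∑ j, m j = d - 1) {x : critSpace m}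
    (hx : Function.Injective (x : ℂ × (Fin p → ℂ)).2) (h : critSpace m)
    (h0 : fderiv ℂ (critCoeffMap d m) x h = 0) : h = 0 := by
  obtain ⟨q, hq, hk, -, hz⟩ := exists_hasCoeffDerivAt_critPoly hd hm hsum hx h
  refine hz (Polynomial.ext fun k => ?_)
  rcases Nat.lt_or_ge k (d - 1) with hlt | hge
  · have h1 := hasDerivAt_comp_line (analyticAt_critCoeffMap (d := d) x).differentiableAt h
    rw [h0, hasDerivAt_pi] at h1
    have h2 := h1 ⟨d - 2 - k, by omega⟩
    simp only [critCoeffMap, ← coeff_eq_coeffVec _ hlt] at h2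
    exact (hq k).unique h2
  · rw [hk k hge, coeff_zero]

/-! ### Dimension count and local biholomorphy -/

theorem finrank_critSpace (hd : 2 ≤ d) (hm : ∀ j, 0 < m j) (hsum : ∑ j, m j = d - 1) :
    Module.finrank ℂ (critSpace m) = p := by
  have hp : 0 < p := by
    rcases Nat.eq_zero_or_pos p with rfl | hp
    · simp at hsum; omega
    · exact hp
  let φ : (ℂ × (Fin p → ℂ)) →ₗ[ℂ] ℂ :=
    (∑ j, (m j : ℂ) • LinearMap.proj (R := ℂ) (φ := fun _ : Fin p => ℂ) j) ∘ₗ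
      LinearMap.snd ℂ ℂ (Fin p → ℂ)
  have hφ : ∀ x, φ x = ∑ j, (m j : ℂ) * x.2 j := by
    intro x; simp [φ]
  have hker : φ.ker = critSpace m := by
    ext x
    rw [LinearMap.mem_ker, hφ]
    rfl
  have hne : φ ≠ 0 := by
    intro h
    have h1 : φ (0, Pi.single ⟨0, hp⟩ 1) = 0 := by rw [h]; rfl
    rw [hφ] at h1
    simp [Pi.single_apply, (hm _).ne'] at h1
  have h1 := Module.Dual.finrank_ker_add_one_of_ne_zero (f := φ) hne
  rw [hker, Module.finrank_prod, Module.finrank_fin_fun, Module.finrank_self] at h1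
  omega

theorem isLocalBiholomorphicAt_critValueMap (hd : 2 ≤ d) (hm : ∀ j, 0 < m j)
    (hsum : ∑ j, m j = d - 1) {x : critSpace m}
    (hx : Function.Injective (x : ℂ × (Fin p → ℂ)).2) :
    IsLocalBiholomorphicAt (critValueMap d m) x :=
  isLocalBiholomorphicAt_of_fderiv_injective
    (by rw [finrank_critSpace hd hm hsum, Module.finrank_fin_fun])
    (analyticAt_critValueMap hd hsum x) (fderiv_critValueMap_injective hd hm hsum hx)

/-- The derivative is injective for all multiplicities; simplicity serves to make the dimensions $p$
and $d-1$ agree. -/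
theorem isLocalBiholomorphicAt_critCoeffMap (hd : 2 ≤ d) (hm : ∀ j, m j = 1)
    (hsum : ∑ j, m j = d - 1) {x : critSpace m}
    (hx : Function.Injective (x : ℂ × (Fin p → ℂ)).2) :
    IsLocalBiholomorphicAt (critCoeffMap d m) x := by
  have hm' : ∀ j, 0 < m j := fun j => by rw [hm j]; exact one_pos
  refine isLocalBiholomorphicAt_of_fderiv_injective ?_
    (analyticAt_critCoeffMap x) (fderiv_critCoeffMap_injective hd hm' hsum hx)
  rw [finrank_critSpace hd hm' hsum, Module.finrank_fin_fun, ← hsum]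
  simp [hm]

/-! ### Markings and permutations -/

theorem exists_eq_of_eval_critDeriv_eq_zero (hd : 2 ≤ d) {c : Fin p → ℂ} {z : ℂ}
    (hz : (critDeriv d m c).eval z = 0) : ∃ j, c j = z := by
  have hd0 : (d : ℂ) ≠ 0 := by exact_mod_cast (by omega : d ≠ 0)
  rw [critDeriv, eval_mul, eval_C, mul_eq_zero, or_iff_right hd0, eval_prod,
    Finset.prod_eq_zero_iff] at hz
  obtain ⟨j, -, hj⟩ := hz
  rw [eval_pow, eval_sub, eval_X, eval_C] at hj
  exact ⟨j, (sub_eq_zero.1 (eq_zero_of_pow_eq_zero hj)).symm⟩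

theorem IsMarking.eval_derivative_eq_zero (hm : ∀ j, 0 < m j) {f : ℂ[X]} {c : Fin p → ℂ}
    (hc : IsMarking m f c) (j : Fin p) : (derivative f).eval (c j) = 0 := by
  have h : 0 < (derivative f).rootMultiplicity (c j) := by rw [hc.2 j]; exact hm j
  by_cases h0 : derivative f = 0
  · rw [h0, eval_zero]
  · exact (rootMultiplicity_pos h0).1 h

theorem IsMarking.comp_perm {f : ℂ[X]} {c : Fin p → ℂ} (hc : IsMarking m f c)
    {σ : Equiv.Perm (Fin p)} (hσ : ∀ j, m (σ j) = m j) : IsMarking m f (c ∘ σ) :=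
  ⟨hc.1.comp σ.injective, fun j => (hc.2 (σ j)).trans (hσ j)⟩

/-- Two markings close to the same separated tuple are equal. -/
theorem IsMarking.eq_of_norm_sub_lt (hd : 2 ≤ d) (hm : ∀ j, 0 < m j) (hsum : ∑ j, m j = d - 1)
    {f : ℂ[X]} (hf : f ∈ PolySpace d m) {c₀ c c' : Fin p → ℂ} {r : ℝ}
    (hr : ∀ i j, i ≠ j → 2 * r ≤ ‖c₀ i - c₀ j‖) (hc : IsMarking m f c)
    (hcr : ∀ j, ‖c j - c₀ j‖ < r) (hc' : IsMarking m f c') (hcr' : ∀ j, ‖c' j - c₀ j‖ < r) :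
    c = c' := by
  ext i
  have h := hc.eval_derivative_eq_zero hm i
  rw [derivative_eq_critDeriv hd hsum hf hc'] at h
  obtain ⟨j, hj⟩ := exists_eq_of_eval_critDeriv_eq_zero hd h
  by_cases hij : i = j
  · rw [← hj, hij]
  -- The common point `c i = c' j` would lie within `r` of both `c₀ i` and `c₀ j`.
  · have h1 : ‖c₀ i - c₀ j‖ ≤ ‖c i - c₀ i‖ + ‖c' j - c₀ j‖ := by
      rw [hj, norm_sub_rev (c i) (c₀ i)]
      exact norm_sub_le_norm_sub_add_norm_sub _ _ _
    linarith [hr i j hij, hcr i, hcr' j]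

/-- A vector of the space encodes the same polynomial as one with distinct `c_j` only if it is
obtained from that one by a permutation preserving the multiplicities. -/
theorem exists_perm_of_critPoly_eq (hd : 2 ≤ d) (hm : ∀ j, 0 < m j) (hsum : ∑ j, m j = d - 1)
    {x y : critSpace m} (hy : Function.Injective (y : ℂ × (Fin p → ℂ)).2)
    (h : critPoly d m x = critPoly d m y) :
    ∃ σ : Equiv.Perm (Fin p), (∀ j, m (σ j) = m j) ∧
      ∀ j, (x : ℂ × (Fin p → ℂ)).2 (σ j) = (y : ℂ × (Fin p → ℂ)).2 j := by
  have hy' := (critPoly_mem hd hsum y hy).2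
  have hroot : ∀ j, ∃ i, (x : ℂ × (Fin p → ℂ)).2 i = (y : ℂ × (Fin p → ℂ)).2 j := by
    intro j
    have h1 := hy'.eval_derivative_eq_zero hm j
    rw [← h, derivative_critPoly] at h1
    exact exists_eq_of_eval_critDeriv_eq_zero hd h1
  choose τ hτ using hroot
  have hτinj : Function.Injective τ := fun i j hij => hy (by rw [← hτ i, ← hτ j, hij])
  let σ : Equiv.Perm (Fin p) := Equiv.ofBijective τ (Finite.injective_iff_bijective.1 hτinj)
  have hσ : ∀ j, (x : ℂ × (Fin p → ℂ)).2 (σ j) = (y : ℂ × (Fin p → ℂ)).2 j := hτ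
  -- Distinctness of the entries of `x` is not assumed; it follows by counting, and lets
  -- multiplicities be read off on both sides.
  have hx : Function.Injective (x : ℂ × (Fin p → ℂ)).2 := by
    have h1 : (x : ℂ × (Fin p → ℂ)).2 = (y : ℂ × (Fin p → ℂ)).2 ∘ σ.symm := by
      ext i
      rw [Function.comp_apply, ← hσ, σ.apply_symm_apply]
    rw [h1]
    exact hy.comp σ.symm.injective
  refine ⟨σ, fun j => ?_, hσ⟩
  rw [← (critPoly_mem hd hsum x hx).2.2 (σ j), ← hy'.2 j, hσ j, h]

/-- Permutation of the entries `c_j` of a vector of the space. -/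
def permCoord (σ : Equiv.Perm (Fin p)) (hσ : ∀ j, m (σ j) = m j) (x : critSpace m) :
    critSpace m :=
  ⟨((x : ℂ × (Fin p → ℂ)).1, (x : ℂ × (Fin p → ℂ)).2 ∘ σ), by
    have hx : ∑ j, (m j : ℂ) * (x : ℂ × (Fin p → ℂ)).2 j = 0 := x.2
    rw [← Equiv.sum_comp σ] at hx
    simp only [hσ] at hx
    exact hx⟩

theorem continuous_permCoord (σ : Equiv.Perm (Fin p)) (hσ : ∀ j, m (σ j) = m j) :
    Continuous (permCoord σ hσ) := by
  unfold permCoord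
  refine Continuous.subtype_mk ?_ _
  exact (continuous_fst.comp continuous_subtype_val).prodMk (continuous_pi fun j =>
    (continuous_apply (σ j)).comp (continuous_snd.comp continuous_subtype_val))

/-! ### Continuity of the critical points in the coefficients -/

/-- A vector of the space is bounded in terms of the coefficients of the encoded polynomial. -/
theorem norm_le_of_norm_critCoeffMap_le (hd : 2 ≤ d) (hm : ∀ j, 0 < m j)
    (hsum : ∑ j, m j = d - 1) {x : critSpace m} {R : ℝ} (hR : ‖critCoeffMap d m x‖ ≤ R) :
    ‖x‖ ≤ R + 1 := by
  have hR0 : 0 ≤ R := (norm_nonneg _).trans hR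
  have hcoeff : ∀ k, k < d → ‖(critPoly d m x).coeff k‖ ≤ R := by
    intro k hk
    rcases Nat.lt_or_ge k (d - 1) with hlt | hge
    · rw [coeff_eq_coeffVec _ hlt]
      exact (norm_le_pi_norm (critCoeffMap d m x) _).trans hR
    · obtain rfl : k = d - 1 := by omega
      rw [coeff_critPoly_sub_one hd hsum x.2, norm_zero]
      exact hR0
  -- The coefficient of index `k` of the product is $(k+1)/d\le 1$ times that of index `k + 1` of
  -- the encoded polynomial.
  have hprod : ∀ k, k < d - 1 →
      ‖(∏ j, (X - C ((x : ℂ × (Fin p → ℂ)).2 j)) ^ m j).coeff k‖ ≤ R := by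
    intro k hk
    have h1 := hcoeff (k + 1) (by omega)
    rw [coeff_critPoly_succ, norm_div, norm_mul, Complex.norm_natCast, ← Nat.cast_add_one,
      Complex.norm_natCast, div_le_iff₀ (by positivity)] at h1
    have hdk : ((k + 1 : ℕ) : ℝ) ≤ d := by exact_mod_cast (by omega : k + 1 ≤ d)
    have hdpos : (0 : ℝ) < d := by exact_mod_cast (by omega : 0 < d)
    have h2 := h1.trans (mul_le_mul_of_nonneg_left hdk hR0)
    rw [mul_comm R] at h2
    exact le_of_mul_le_mul_left h2 hdpos
  have hmon := monic_prod m (x : ℂ × (Fin p → ℂ)).2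
  change ‖(x : ℂ × (Fin p → ℂ))‖ ≤ R + 1
  rw [Prod.norm_def, max_le_iff, pi_norm_le_iff_of_nonneg (by linarith)]
  constructor
  · rw [← coeff_critPoly_zero (d := d) (m := m)]
    exact (hcoeff 0 (by omega)).trans (by linarith)
  · intro j
    have hroot : (∏ j, (X - C ((x : ℂ × (Fin p → ℂ)).2 j)) ^ m j).IsRoot
        ((x : ℂ × (Fin p → ℂ)).2 j) := by
      rw [IsRoot.def, eval_prod]
      exact Finset.prod_eq_zero (Finset.mem_univ j) (by simp [(hm j).ne'])
    have h1 := hroot.norm_lt_cauchyBound hmon.ne_zero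
    have h2 : cauchyBound (∏ j, (X - C ((x : ℂ × (Fin p → ℂ)).2 j)) ^ m j) ≤
        R.toNNReal + 1 := by
      rw [cauchyBound, hmon.leadingCoeff, nnnorm_one, div_one, natDegree_prod, hsum]
      gcongr
      refine Finset.sup_le fun k hk => ?_
      rw [← norm_toNNReal]
      exact Real.toNNReal_le_toNNReal (hprod k (Finset.mem_range.1 hk))
    have h3 : ((‖(x : ℂ × (Fin p → ℂ)).2 j‖₊ : NNReal) : ℝ) ≤ ((R.toNNReal + 1 : NNReal) : ℝ) :=
      NNReal.coe_le_coe.2 (h1.le.trans h2)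
    rwa [NNReal.coe_add, NNReal.coe_one, Real.coe_toNNReal R hR0, coe_nnnorm] at h3

/-- The coefficients determine the vector of the space up to a permutation preserving the
multiplicities, in a continuous way. -/
theorem eventually_exists_permCoord_mem (hd : 2 ≤ d) (hm : ∀ j, 0 < m j)
    (hsum : ∑ j, m j = d - 1) {x₀ : critSpace m}
    (hx₀ : Function.Injective (x₀ : ℂ × (Fin p → ℂ)).2) {U : Set (critSpace m)} (hU : U ∈ 𝓝 x₀) :
    ∀ᶠ a in 𝓝 (critCoeffMap d m x₀), ∀ x, critCoeffMap d m x = a →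
      ∃ (σ : Equiv.Perm (Fin p)) (hσ : ∀ j, m (σ j) = m j), permCoord σ hσ x ∈ U := by
  have : ProperSpace (critSpace m) := FiniteDimensional.proper ℂ _
  let R := ‖critCoeffMap d m x₀‖ + 1
  -- The bad vectors: bounded, with no admissible permutation in the interior of `U`. Using the
  -- interior makes `B` closed, hence compact, and its image is a closed set that misses the base
  -- point.
  let B : Set (critSpace m) := Metric.closedBall 0 (R + 1) ∩
    ⋂ (σ : Equiv.Perm (Fin p)) (hσ : ∀ j, m (σ j) = m j), permCoord σ hσ ⁻¹' (interior U)ᶜ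
  have hB : IsCompact B := (isCompact_closedBall _ _).inter_right
    (isClosed_iInter fun σ => isClosed_iInter fun hσ =>
      isOpen_interior.isClosed_compl.preimage (continuous_permCoord σ hσ))
  have hΦ : Continuous (critCoeffMap d m) :=
    continuous_iff_continuousAt.2 fun x => (analyticAt_critCoeffMap x).continuousAt
  have hnot : critCoeffMap d m x₀ ∉ critCoeffMap d m '' B := by
    rintro ⟨x, hxB, hx⟩
    obtain ⟨σ, hσ, hxσ⟩ := exists_perm_of_critPoly_eq hd hm hsum hx₀
      (critPoly_eq_of_coeffVec_eq hd hsum x.2 x₀.2 hx)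
    have h1 : permCoord σ hσ x = x₀ := by
      refine Subtype.ext (Prod.ext ?_ (funext hxσ))
      change (x : ℂ × (Fin p → ℂ)).1 = _
      rw [← coeff_critPoly_zero (d := d) (m := m),
        critPoly_eq_of_coeffVec_eq hd hsum x.2 x₀.2 hx, coeff_critPoly_zero]
    have h2 := Set.mem_iInter₂.1 hxB.2 σ hσ
    rw [Set.mem_preimage, h1] at h2
    exact h2 (mem_interior_iff_mem_nhds.2 hU)
  filter_upwards [(hB.image hΦ).isClosed.isOpen_compl.mem_nhds hnot,
    Metric.ball_mem_nhds (critCoeffMap d m x₀) one_pos] with a ha ha1 x hx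
  by_contra! hcon
  refine ha ⟨x, ⟨?_, ?_⟩, hx⟩
  · rw [mem_closedBall_zero_iff]
    refine norm_le_of_norm_critCoeffMap_le hd hm hsum ?_
    rw [hx]
    rw [mem_ball_iff_norm] at ha1
    have := norm_le_norm_add_norm_sub' a (critCoeffMap d m x₀)
    change ‖a‖ ≤ ‖critCoeffMap d m x₀‖ + 1
    linarith
  · exact Set.mem_iInter₂.2 fun σ hσ hmem => hcon σ hσ (interior_subset hmem)

theorem critValueMap_critCoord (hd : 2 ≤ d) (hsum : ∑ j, m j = d - 1) {f : ℂ[X]}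
    (hf : f ∈ PolySpace d m) {c : Fin p → ℂ} (hc : IsMarking m f c) :
    critValueMap d m (critCoord hd hsum hf hc) = critValues f c := by
  rw [critValueMap, critPoly_critCoord]
  rfl

theorem critCoeffMap_critCoord (hd : 2 ≤ d) (hsum : ∑ j, m j = d - 1) {f : ℂ[X]}
    (hf : f ∈ PolySpace d m) {c : Fin p → ℂ} (hc : IsMarking m f c) :
    critCoeffMap d m (critCoord hd hsum hf hc) = coeffVec d f := by
  rw [critCoeffMap, critPoly_critCoord]

theorem isOpen_setOf_norm_snd_sub_lt (c₀ : Fin p → ℂ) (r : ℝ) :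
    IsOpen {x : critSpace m | ∀ j, ‖(x : ℂ × (Fin p → ℂ)).2 j - c₀ j‖ < r} := by
  simp only [Set.ofPred_forall]
  refine isOpen_iInter_of_finite fun j => isOpen_lt ?_ continuous_const
  exact (((continuous_apply j).comp (continuous_snd.comp continuous_subtype_val)).sub
    continuous_const).norm

end CritCoord

theorem proposition1 {d p : ℕ} (hd : 2 ≤ d) (m : Fin p → ℕ) (hm : ∀ j, 0 < m j)
    (hsum : ∑ j, m j = d - 1) (f₀ : ℂ[X]) (hf₀ : f₀ ∈ CritCoord.PolySpace d m)
    (c₀ : Fin p → ℂ) (hc₀ : CritCoord.IsMarking m f₀ c₀) :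
    CritCoord.IsLocalBiholomorphicAt (CritCoord.critValueMap d m)
      (CritCoord.critCoord hd hsum hf₀ hc₀) ∧
    ∃ F : (Fin p → ℂ) → (Fin (d - 1) → ℂ),
      AnalyticAt ℂ F (CritCoord.critValues f₀ c₀) ∧
      (∀ r : ℝ, 0 < r → (∀ i j, i ≠ j → 2 * r ≤ ‖c₀ i - c₀ j‖) →
        (∀ᶠ a in 𝓝 (CritCoord.coeffVec d f₀), ∀ f ∈ CritCoord.PolySpace d m,
          CritCoord.coeffVec d f = a →
            (∃! c, CritCoord.IsMarking m f c ∧ ∀ j, ‖c j - c₀ j‖ < r) ∧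
            ∀ c, CritCoord.IsMarking m f c → (∀ j, ‖c j - c₀ j‖ < r) →
              F (CritCoord.critValues f c) = a) ∧
        (∀ᶠ v in 𝓝 (CritCoord.critValues f₀ c₀), ∃ f ∈ CritCoord.PolySpace d m, ∃ c,
          CritCoord.IsMarking m f c ∧ (∀ j, ‖c j - c₀ j‖ < r) ∧
            CritCoord.critValues f c = v ∧ CritCoord.coeffVec d f = F v)) ∧
      ((∀ j, m j = 1) →
        CritCoord.IsLocalBiholomorphicAt F (CritCoord.critValues f₀ c₀)) := by
  open CritCoord in
  have hx₀ : Function.Injective (critCoord hd hsum hf₀ hc₀ : ℂ × (Fin p → ℂ)).2 := hc₀.1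
  have hbih := isLocalBiholomorphicAt_critValueMap hd hm hsum hx₀
  refine ⟨hbih, ?_⟩
  obtain ⟨e, hx₀e, heq, -, hsymm⟩ := hbih
  have hev₀ : e (critCoord hd hsum hf₀ hc₀) = critValues f₀ c₀ := by
    rw [heq hx₀e, critValueMap_critCoord]
  have hv₀ : critValues f₀ c₀ ∈ e.target := hev₀ ▸ e.map_source hx₀e
  have hesymm : e.symm (critValues f₀ c₀) = critCoord hd hsum hf₀ hc₀ := by
    rw [← hev₀, e.left_inv hx₀e]
  -- This $F=\Phi\circ\pi^{-1}$ is chosen before `r`; off `e.target` its values are immaterial.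
  refine ⟨fun v => critCoeffMap d m (e.symm v),
    (analyticAt_critCoeffMap _).comp (hsymm _ hv₀), fun r hr hsep => ⟨?_, ?_⟩, fun hm1 => ?_⟩
  · have hV : {x : critSpace m | ∀ j, ‖(x : ℂ × (Fin p → ℂ)).2 j - c₀ j‖ < r} ∈
        𝓝 (critCoord hd hsum hf₀ hc₀) :=
      (isOpen_setOf_norm_snd_sub_lt c₀ r).mem_nhds fun j => by simpa [critCoord] using hr
    -- Closeness within `r` fixes the marking; membership in `e.source` lets `e.symm` recover its
    -- coordinates.
    have hev := eventually_exists_permCoord_mem hd hm hsum hx₀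
      (inter_mem (e.open_source.mem_nhds hx₀e) hV)
    rw [critCoeffMap_critCoord] at hev
    filter_upwards [hev] with a ha f hf hfa
    obtain ⟨-, -, -, c, hc⟩ := id hf
    obtain ⟨σ, hσ, hσe, hσr⟩ := ha (critCoord hd hsum hf hc)
      ((critCoeffMap_critCoord hd hsum hf hc).trans hfa)
    have hcσ : IsMarking m f (c ∘ σ) := hc.comp_perm hσ
    have huniq : ∀ c', IsMarking m f c' → (∀ j, ‖c' j - c₀ j‖ < r) → c' = c ∘ σ :=
      fun c' hc' hcr' => hc'.eq_of_norm_sub_lt hd hm hsum hf hsep hcr' hcσ hσr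
    refine ⟨⟨c ∘ σ, ⟨hcσ, hσr⟩, fun c' h => huniq c' h.1 h.2⟩, fun c' hc' hcr' => ?_⟩
    obtain rfl := huniq c' hc' hcr'
    have hmem : critCoord hd hsum hf hcσ ∈ e.source := hσe
    change critCoeffMap d m (e.symm (critValues f (c ∘ σ))) = a
    rw [← critValueMap_critCoord hd hsum hf hcσ, ← heq hmem, e.left_inv hmem,
      critCoeffMap_critCoord, hfa]
  · have hV : {x : critSpace m | ∀ j, ‖(x : ℂ × (Fin p → ℂ)).2 j - c₀ j‖ < r} ∈
        𝓝 (e.symm (critValues f₀ c₀)) :=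
      (isOpen_setOf_norm_snd_sub_lt c₀ r).mem_nhds fun j => by
        rw [hesymm]; simpa [critCoord] using hr
    filter_upwards [e.open_target.mem_nhds hv₀,
      (e.continuousAt_symm hv₀).preimage_mem_nhds hV] with v hv hvr
    -- Entries within `r` of points at mutual distance at least `2 * r` are distinct.
    have hinj : Function.Injective (e.symm v : ℂ × (Fin p → ℂ)).2 := by
      intro i j hij
      by_contra hne
      have h1 := hvr i
      have h2 := hvr j
      have h3 := norm_sub_le_norm_sub_add_norm_sub (c₀ i) ((e.symm v : ℂ × (Fin p → ℂ)).2 i) (c₀ j)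
      rw [norm_sub_rev (c₀ i) ((e.symm v : ℂ × (Fin p → ℂ)).2 i), hij] at h3
      rw [hij] at h1
      linarith [hsep i j hne]
    obtain ⟨hmem, hmark⟩ := critPoly_mem hd hsum (e.symm v) hinj
    refine ⟨_, hmem, _, hmark, hvr, ?_, rfl⟩
    change critValueMap d m (e.symm v) = v
    rw [← heq (e.map_target hv), e.right_inv hv]
  · obtain ⟨g, hx₀g, hgeq, hg, hgsymm⟩ := isLocalBiholomorphicAt_critCoeffMap hd hm1 hsum hx₀
    refine ⟨e.symm.trans g, ?_, fun v hv => ?_, fun v hv => ?_, fun a ha => ?_⟩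
    · rw [OpenPartialHomeomorph.trans_source]
      exact ⟨hv₀, by rw [Set.mem_preimage, hesymm]; exact hx₀g⟩
    · rw [OpenPartialHomeomorph.trans_source] at hv
      exact hgeq hv.2
    · rw [OpenPartialHomeomorph.trans_source] at hv
      exact (hg _ hv.2).comp (hsymm _ hv.1)
    · rw [OpenPartialHomeomorph.trans_target] at ha
      -- The inverse of $F$ is $\pi\circ\Phi^{-1}$; `e` agrees with the analytic map $\pi$ on its
      -- open source.
      have he : AnalyticAt ℂ e (g.symm a) := by
        have h1 := (analyticAt_critValueMap hd hsum (g.symm a))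
        exact h1.congr (heq.symm.eventuallyEq_of_mem (e.open_source.mem_nhds ha.2))
      exact he.comp (hgsymm _ ha.1)
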